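/- Call a (multiple) sequence of rationals recursive if it has the form $(-1)^{s}p/q$ with total recursive functions $s,p,q$ of its indices and $q\neq 0$. A (multiple) sequence of reals $\{x_i\}$ is computable if there is a recursive sequence of rationals $\{r_{i,k}\}$ with $|r_{i,k}-x_i|\le 2^{-k}$ for all $i,k$; a sequence of complex numbers $\{z_i\}$ is computable if there are recursive sequences of rationals $\{r_{i,k}\},\{s_{i,k}\}$ with $|r_{i,k}+\sqrt{-1}\,s_{i,k}-z_i|\le 2^{-k}$ for all $i,k$. A sequence of functions $f_n:\mathbb R\to\mathbb R$ is computable if (i) $\{f_n(x_j)\}_{n,j}$ is a computable double sequence for every computable sequence of reals $\{x_j\}$, and (ii) there is a recursive function $\alpha(n,L,k)$ such that $|x|,|y|\le L$ and $|x-y|<2^{-\alpha(n,L,k)}$ imply $|f_n(x)-f_n(y)|<2^{-k}$. It is computable with compact support if, in addition, there is a recursive function $L(n)$ with $f_n(x)=0$ whenever $|x|\ge L(n)$. A sequence $\{\mu_m\}$ of probability distributions (Borel probability measures on $\mathbb R$) is computable if $\{\int f_n\,d\mu_m\}_{m,n}$ is a computable double sequence of reals for every sequence $\{f_n\}$ that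 is computable with compact support. **Theorem 4.1.** If a sequence of probability distributions $\{\mu_m\}$ is computable, then the corresponding sequence of characteristic functions $\varphi_m(t)=\int_{\mathbb R}e^{itx}\,\mu_m(dx)$ is uniformly computable, that is: 1. $\{\varphi_m(t_n)\}_{m,n}$ is a computable double sequence of complex numbers for every computable sequence of reals $\{t_n\}$; and 2. there is a recursive function $\alpha(m,k)$ such that, for all $m,k$ and all $t,u\in\mathbb R$, $|t-u|<2^{-\alpha(m,k)}$ implies $|\varphi_m(t)-\varphi_m(u)|<2^{-k}$. -/

import Mathlib

open MeasureTheory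

namespace CompProb

/-- A (multiple) sequence of rationals is recursive if it is `(-1)^s * p / q` for recursive
`s`, `p`, `q` with `q` never zero. The index type `ι` is `ℕ`, `ℕ × ℕ`, and so on. -/
def RecursiveRat {ι : Type} [Primcodable ι] (r : ι → ℚ) : Prop :=
  ∃ s p q : ι → ℕ, Computable s ∧ Computable p ∧ Computable q ∧
    ∀ i, q i ≠ 0 ∧ r i = (-1) ^ s i * (p i : ℚ) / (q i : ℚ)

/-- A (multiple) sequence of reals is computable if it is effectively approximated by a
recursive sequence of rationals with one more index. -/
def ComputableRealSeq {ι : Type} [Primcodable ι] (x : ι → ℝ) : Prop :=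
  ∃ r : ι × ℕ → ℚ, RecursiveRat r ∧ ∀ i k, |(r (i, k) : ℝ) - x i| ≤ (1 / 2 : ℝ) ^ k

/-- A (multiple) sequence of complex numbers is computable if it is effectively approximated by
a recursive sequence `r + i s` of rational complex numbers. -/
def ComputableComplexSeq {ι : Type} [Primcodable ι] (z : ι → ℂ) : Prop :=
  ∃ r s : ι × ℕ → ℚ, RecursiveRat r ∧ RecursiveRat s ∧
    ∀ i k, ‖((r (i, k) : ℂ) + (s (i, k) : ℂ) * Complex.I) - z i‖ ≤ (1 / 2 : ℝ) ^ k

/-- A sequence of real functions on `ℝ` is computable: sequential computability together with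
effective continuity (a recursive modulus of continuity on each `[-L, L]`). -/
structure ComputableFunSeq (f : ℕ → ℝ → ℝ) : Prop where
  sequential : ∀ x : ℕ → ℝ, ComputableRealSeq x →
    ComputableRealSeq fun i : ℕ × ℕ => f i.1 (x i.2)
  effectivelyContinuous : ∃ α : ℕ × ℕ × ℕ → ℕ, Computable α ∧
    ∀ (n L k : ℕ) (x y : ℝ), |x| ≤ L → |y| ≤ L → |x - y| < (1 / 2 : ℝ) ^ α (n, L, k) →
      |f n x - f n y| < (1 / 2 : ℝ) ^ k

/-- A computable sequence of functions with compact support: moreover `f n` vanishes where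
`|x| ≥ L n`, for a recursive `L`. -/
def ComputableCompactSupport (f : ℕ → ℝ → ℝ) : Prop :=
  ComputableFunSeq f ∧
    ∃ L : ℕ → ℕ, Computable L ∧ ∀ (n : ℕ) (x : ℝ), (L n : ℝ) ≤ |x| → f n x = 0

/-- A sequence of probability distributions is computable if `∫ f n ∂(μ m)` is a computable
double sequence of reals for every computable sequence `f` with compact support. -/
def ComputableDistSeq (μ : ℕ → Measure ℝ) : Prop :=
  ∀ f : ℕ → ℝ → ℝ, ComputableCompactSupport f →
    ComputableRealSeq fun i : ℕ × ℕ => ∫ x, f i.2 x ∂(μ i.1)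

/-- A sequence of complex-valued functions on `ℝ` is uniformly computable: sequential
computability together with effective uniform continuity, that is, a recursive modulus of
continuity valid on all of `ℝ`. -/
structure UniformlyComputableFunSeq (φ : ℕ → ℝ → ℂ) : Prop where
  sequential : ∀ t : ℕ → ℝ, ComputableRealSeq t →
    ComputableComplexSeq fun i : ℕ × ℕ => φ i.1 (t i.2)
  effectivelyUniformlyContinuous : ∃ α : ℕ × ℕ → ℕ, Computable α ∧
    ∀ (m k : ℕ) (t u : ℝ), |t - u| < (1 / 2 : ℝ) ^ α (m, k) →
      ‖φ m t - φ m u‖ < (1 / 2 : ℝ) ^ k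

end CompProb

/-! Computability of a distribution is tested only on compactly supported functions, so the crux is
effective tightness. For fixed `m` the integrals of wider and wider tents tend to 1, and a search
through their rational approximations finds, recursively in `m` and `k`, a tent of integral at least
1 - 2^(-k) (`ComputableDistSeq.exists_tent`). Cutting cos(tx) and sin(tx) off by that tent moves
their integrals by at most 2^(-k), and the cut-off functions are computable with compact support;
this gives the real and imaginary parts of the characteristic function
(`ComputableDistSeq.computableRealSeq_integral`). That cos and sin preserve computability comes from
Taylor sums of recursively chosen degree (`ComputableRealSeq.of_trigPartialSum`). For the modulus of
continuity, e^(itx) is |x|-Lipschitz in t on the support of the tent, and the mass missed by the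
tent controls the rest (`norm_charFun_sub_charFun_le`). -/

namespace CompProb

/-! ### Recursive arithmetic on ℕ and unbounded search. -/

section Nat

variable {ι : Type} [Primcodable ι] {f g : ι → ℕ}

theorem computable_add (hf : Computable f) (hg : Computable g) : Computable fun i => f i + g i :=
  Primrec.nat_add.to_comp.comp hf hg

theorem computable_sub (hf : Computable f) (hg : Computable g) : Computable fun i => f i - g i :=
  Primrec.nat_sub.to_comp.comp hf hg

theorem computable_mul (hf : Computable f) (hg : Computable g) : Computable fun i => f i * g i :=
  Primrec.nat_mul.to_comp.comp hf hg

theorem computable_mod (hf : Computable f) (hg : Computable g) : Computable fun i => f i % g i :=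
  Primrec.nat_mod.to_comp.comp hf hg

theorem computable_pow (hf : Computable f) (hg : Computable g) : Computable fun i => f i ^ g i :=
  (Primrec₂.unpaired'.1 Nat.Primrec.pow).to_comp.comp hf hg

theorem computable_factorial (hf : Computable f) : Computable fun i => (f i).factorial := by
  have h : Computable fun i => Nat.rec (motive := fun _ => ℕ) 1 (fun y IH => (y + 1) * IH) (f i) :=
    Computable.nat_rec hf (Computable.const 1)
      (computable_mul (Computable.succ.comp (Computable.fst.comp Computable.snd))
        (Computable.snd.comp Computable.snd)).to₂
  refine h.of_eq fun i => ?_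
  induction f i with
  | zero => rfl
  | succ n ih => rw [Nat.factorial_succ, ← ih]

/-- Unbounded search for a zero of a total recursive function is total recursive as soon as a zero
exists for every parameter. -/
theorem exists_computable_zero {f : ι × ℕ → ℕ} (hf : Computable f) (h : ∀ i, ∃ n, f (i, n) = 0) :
    ∃ N : ι → ℕ, Computable N ∧ ∀ i, f (i, N i) = 0 := by
  have hp : Computable₂ fun (i : ι) (n : ℕ) => decide (f (i, n) = 0) :=
    (Primrec.eq.comp (Primrec.id (α := ℕ)) (Primrec.const 0)).decide.to_comp.comp hf |>.to₂
  refine ⟨fun i => Nat.find (h i), (Partrec.rfind hp.partrec₂).of_eq_tot fun i => ?_,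
    fun i => Nat.find_spec (h i)⟩
  simp only [Nat.mem_rfind]
  refine ⟨by simpa using Nat.find_spec (h i), fun {m} hm => by simpa using Nat.find_min (h i) hm⟩

end Nat

/-! ### Closure properties of recursive sequences of rationals. -/

namespace RecursiveRat

variable {ι κ : Type} [Primcodable ι] [Primcodable κ] {r r' : ι → ℚ}

theorem comp (hr : RecursiveRat r) {e : κ → ι} (he : Computable e) :
    RecursiveRat fun j => r (e j) := by
  obtain ⟨s, p, q, hs, hp, hq, h⟩ := hr
  exact ⟨_, _, _, hs.comp he, hp.comp he, hq.comp he, fun j => h (e j)⟩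

theorem natCast {f : ι → ℕ} (hf : Computable f) : RecursiveRat fun i => (f i : ℚ) :=
  ⟨fun _ => 0, f, fun _ => 1, .const _, hf, .const _, fun i => by simp⟩

theorem inv_natCast {f : ι → ℕ} (hf : Computable f) (h : ∀ i, f i ≠ 0) :
    RecursiveRat fun i => (f i : ℚ)⁻¹ :=
  ⟨fun _ => 0, fun _ => 1, f, .const _, .const _, hf, fun i => by simp [h i]⟩

theorem mul (hr : RecursiveRat r) (hr' : RecursiveRat r') : RecursiveRat fun i => r i * r' i := by
  obtain ⟨s, p, q, hs, hp, hq, h⟩ := hr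
  obtain ⟨s', p', q', hs', hp', hq', h'⟩ := hr'
  refine ⟨_, _, _, computable_add hs hs', computable_mul hp hp', computable_mul hq hq',
    fun i => ⟨mul_ne_zero (h i).1 (h' i).1, ?_⟩⟩
  beta_reduce
  rw [(h i).2, (h' i).2]
  push_cast
  rw [pow_add, div_mul_div_comm]
  ring

theorem neg (hr : RecursiveRat r) : RecursiveRat fun i => -r i := by
  obtain ⟨s, p, q, hs, hp, hq, h⟩ := hr
  refine ⟨_, p, q, computable_add hs (.const 1), hp, hq, fun i => ⟨(h i).1, ?_⟩⟩
  beta_reduce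
  rw [(h i).2]
  ring

theorem pow (hr : RecursiveRat r) {e : ι → ℕ} (he : Computable e) :
    RecursiveRat fun i => r i ^ e i := by
  obtain ⟨s, p, q, hs, hp, hq, h⟩ := hr
  refine ⟨_, _, _, computable_mul hs he, computable_pow hp he, computable_pow hq he,
    fun i => ⟨pow_ne_zero _ (h i).1, ?_⟩⟩
  beta_reduce
  rw [(h i).2]
  push_cast
  rw [div_pow, mul_pow, pow_mul]

theorem abs (hr : RecursiveRat r) : RecursiveRat fun i => |r i| := by
  obtain ⟨s, p, q, hs, hp, hq, h⟩ := hr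
  refine ⟨fun _ => 0, p, q, .const _, hp, hq, fun i => ⟨(h i).1, ?_⟩⟩
  beta_reduce
  rw [(h i).2, abs_div, abs_mul, abs_neg_one_pow]
  simp

theorem max_zero (hr : RecursiveRat r) : RecursiveRat fun i => max (r i) 0 := by
  obtain ⟨s, p, q, hs, hp, hq, h⟩ := hr
  -- The factor `1 - s % 2` kills the numerator exactly when the sign is negative.
  refine ⟨fun _ => 0, _, q, .const _,
    computable_mul hp (computable_sub (.const 1) (computable_mod hs (.const 2))), hq,
    fun i => ⟨(h i).1, ?_⟩⟩
  beta_reduce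
  rw [(h i).2]
  have h0 : (0 : ℚ) ≤ (p i : ℚ) / q i := by positivity
  rcases Nat.even_or_odd (s i) with hs | hs
  · rw [hs.neg_one_pow, Nat.even_iff.1 hs, one_mul, max_eq_left h0]
    simp
  · rw [hs.neg_one_pow, Nat.odd_iff.1 hs, neg_one_mul, neg_div, max_eq_right (by linarith)]
    simp

/-- A recursive sequence of rationals is a difference of naturals over a positive natural. -/
theorem exists_sub_div (hr : RecursiveRat r) : ∃ a b q : ι → ℕ,
    Computable a ∧ Computable b ∧ Computable q ∧ ∀ i, q i ≠ 0 ∧ r i = ((a i : ℚ) - b i) / q i := by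
  obtain ⟨s, p, q, hs, hp, hq, h⟩ := hr
  have hm : Computable fun i => s i % 2 := computable_mod hs (.const 2)
  refine ⟨_, _, q, computable_mul hp (computable_sub (.const 1) hm), computable_mul hp hm, hq,
    fun i => ⟨(h i).1, ?_⟩⟩
  rw [(h i).2]
  rcases Nat.even_or_odd (s i) with hs | hs
  · simp [hs.neg_one_pow, Nat.even_iff.1 hs]
  · simp [hs.neg_one_pow, Nat.odd_iff.1 hs]

theorem of_sub_div {a b q : ι → ℕ} (ha : Computable a) (hb : Computable b) (hq : Computable q)
    (h : ∀ i, q i ≠ 0 ∧ r i = ((a i : ℚ) - b i) / q i) : RecursiveRat r := by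
  -- With truncated subtraction, `1 - (a + 1 - b)` is 0 if `b ≤ a` and 1 otherwise, and `(a - b) +
  -- (b - a)` is |a - b|.
  refine ⟨_, _, q, computable_sub (.const 1) (computable_sub (computable_add ha (.const 1)) hb),
    computable_add (computable_sub ha hb) (computable_sub hb ha), hq, fun i => ⟨(h i).1, ?_⟩⟩
  rw [(h i).2]
  congr 1
  rcases le_or_gt (b i) (a i) with hab | hab
  · have h1 : 1 - (a i + 1 - b i) = 0 := by omega
    have h2 : b i - a i = 0 := by omega
    rw [h1, h2]
    push_cast [hab]
    ring
  · have h1 : 1 - (a i + 1 - b i) = 1 := by omega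
    have h2 : a i - b i = 0 := by omega
    rw [h1, h2]
    push_cast [hab.le]
    ring

/-- Primitive recursion on the triple (positive part, negative part, denominator) of the unreduced
fraction keeps the whole computation in ℕ. -/
theorem sum_range {r : ι × ℕ → ℚ} (hr : RecursiveRat r) {n : ι → ℕ} (hn : Computable n) :
    RecursiveRat fun i => ∑ j ∈ Finset.range (n i), r (i, j) := by
  obtain ⟨a, b, q, ha, hb, hq, h⟩ := hr.exists_sub_div
  let step : ι → ℕ × (ℕ × ℕ × ℕ) → ℕ × ℕ × ℕ := fun i s =>
    (s.2.1 * q (i, s.1) + a (i, s.1) * s.2.2.2, s.2.2.1 * q (i, s.1) + b (i, s.1) * s.2.2.2,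
      s.2.2.2 * q (i, s.1))
  have hidx : Computable fun z : ι × (ℕ × (ℕ × ℕ × ℕ)) => (z.1, z.2.1) :=
    Computable.fst.pair (Computable.fst.comp Computable.snd)
  have hA : Computable fun z : ι × (ℕ × (ℕ × ℕ × ℕ)) => z.2.2.1 :=
    Computable.fst.comp (Computable.snd.comp Computable.snd)
  have hB : Computable fun z : ι × (ℕ × (ℕ × ℕ × ℕ)) => z.2.2.2.1 :=
    Computable.fst.comp (Computable.snd.comp (Computable.snd.comp Computable.snd))
  have hQ : Computable fun z : ι × (ℕ × (ℕ × ℕ × ℕ)) => z.2.2.2.2 :=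
    Computable.snd.comp (Computable.snd.comp (Computable.snd.comp Computable.snd))
  have hstep : Computable₂ step := by
    refine Computable₂.mk (Computable.pair ?_ (Computable.pair ?_ ?_))
    · exact computable_add (computable_mul hA (hq.comp hidx)) (computable_mul (ha.comp hidx) hQ)
    · exact computable_add (computable_mul hB (hq.comp hidx)) (computable_mul (hb.comp hidx) hQ)
    · exact computable_mul hQ (hq.comp hidx)
  have hrec := Computable.nat_rec hn (Computable.const ((0, 0, 1) : ℕ × ℕ × ℕ)) hstep
  refine of_sub_div (Computable.fst.comp hrec)
    (Computable.fst.comp (Computable.snd.comp hrec))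
    (Computable.snd.comp (Computable.snd.comp hrec)) fun i => ?_
  induction n i with
  | zero => simp
  | succ m ih =>
    obtain ⟨ih1, ih2⟩ := ih
    refine ⟨mul_ne_zero ih1 (h (i, m)).1, ?_⟩
    have h1 := Nat.cast_ne_zero (R := ℚ).2 ih1
    have h2 := Nat.cast_ne_zero (R := ℚ).2 (h (i, m)).1
    rw [Finset.sum_range_succ, ih2, (h (i, m)).2, div_add_div _ _ h1 h2]
    simp only [step]
    push_cast
    congr 1
    ring

theorem add (hr : RecursiveRat r) (hr' : RecursiveRat r') : RecursiveRat fun i => r i + r' i := by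
  obtain ⟨a, b, q, ha, hb, hq, h⟩ := hr.exists_sub_div
  obtain ⟨a', b', q', ha', hb', hq', h'⟩ := hr'.exists_sub_div
  refine of_sub_div (computable_add (computable_mul ha hq') (computable_mul ha' hq))
    (computable_add (computable_mul hb hq') (computable_mul hb' hq)) (computable_mul hq hq')
    fun i => ⟨mul_ne_zero (h i).1 (h' i).1, ?_⟩
  rw [(h i).2, (h' i).2, div_add_div _ _ (Nat.cast_ne_zero.2 (h i).1)
    (Nat.cast_ne_zero.2 (h' i).1)]
  push_cast
  congr 1
  ring

/-- Search for an index at which a recursive sequence of rationals is nonnegative. -/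
theorem exists_computable_nonneg {r : ι × ℕ → ℚ} (hr : RecursiveRat r)
    (h : ∀ i, ∃ n, 0 ≤ r (i, n)) : ∃ N : ι → ℕ, Computable N ∧ ∀ i, 0 ≤ r (i, N i) := by
  obtain ⟨a, b, q, ha, hb, hq, hab⟩ := hr.exists_sub_div
  have key : ∀ i, 0 ≤ r i ↔ b i - a i = 0 := fun i => by
    have : (0 : ℚ) < q i := by exact_mod_cast Nat.pos_of_ne_zero (hab i).1
    rw [(hab i).2, le_div_iff₀ this, zero_mul, sub_nonneg, Nat.cast_le, Nat.sub_eq_zero_iff_le]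
  simp only [key] at h ⊢
  exact exists_computable_zero (computable_sub hb ha) h

end RecursiveRat

end CompProb

namespace CompProb

/-! ### Arithmetic of computable sequences of reals. -/

namespace ComputableRealSeq

variable {ι κ : Type} [Primcodable ι] [Primcodable κ] {x y : ι → ℝ}

theorem comp (hx : ComputableRealSeq x) {e : κ → ι} (he : Computable e) :
    ComputableRealSeq fun j => x (e j) := by
  obtain ⟨r, hr, h⟩ := hx
  exact ⟨fun z => r (e z.1, z.2), hr.comp ((he.comp .fst).pair .snd), fun j k => h (e j) k⟩

/-- An approximation with error `B i * 2⁻ᵏ` for a recursive `B` suffices for computability. -/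
theorem of_bound {r : ι × ℕ → ℚ} (hr : RecursiveRat r) {B : ι → ℕ} (hB : Computable B)
    (h : ∀ i k, |(r (i, k) : ℝ) - x i| ≤ B i * (1 / 2 : ℝ) ^ k) : ComputableRealSeq x := by
  -- Since `B ≤ 2 ^ B`, reading the approximation `B i` places further absorbs the factor.
  refine ⟨fun z => r (z.1, z.2 + B z.1),
    hr.comp (Computable.fst.pair (computable_add .snd (hB.comp .fst))), fun i k => ?_⟩
  refine (h i (k + B i)).trans ?_
  have h2 : (B i : ℝ) ≤ 2 ^ B i := by exact_mod_cast Nat.lt_two_pow_self.le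
  rw [pow_add, mul_left_comm]
  refine mul_le_of_le_one_right (by positivity) ?_
  rw [one_div, inv_pow]
  exact (mul_inv_le_iff₀ (by positivity)).2 (by simpa using h2)

theorem of_rat {r : ι → ℚ} (hr : RecursiveRat r) : ComputableRealSeq fun i => (r i : ℝ) :=
  ⟨fun z => r z.1, hr.comp .fst, fun i k => by simp⟩

/-- The terms of a computable sequence of reals have recursive bounds. -/
theorem exists_bound (hx : ComputableRealSeq x) :
    ∃ B : ι → ℕ, Computable B ∧ ∀ i, |x i| ≤ B i := by
  obtain ⟨r, ⟨s, p, q, hs, hp, hq, h⟩, hrx⟩ := hx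
  have h0 : Computable fun i : ι => (i, 0) := Computable.id.pair (.const 0)
  refine ⟨_, computable_add (hp.comp h0) (.const 1), fun i => ?_⟩
  have h1 := hrx i 0
  have h2 : |r (i, 0)| ≤ p (i, 0) := by
    rw [(h (i, 0)).2, abs_div, abs_mul, abs_neg_one_pow, one_mul, Nat.abs_cast, Nat.abs_cast]
    exact div_le_self (Nat.cast_nonneg _)
      (by exact_mod_cast Nat.one_le_iff_ne_zero.2 (h (i, 0)).1)
  have h3 : |(r (i, 0) : ℝ)| ≤ p (i, 0) := by exact_mod_cast h2
  rw [abs_le] at *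
  push_cast
  constructor <;> linarith [h1.1, h1.2, h3.1, h3.2, pow_zero (1 / 2 : ℝ)]

theorem neg (hx : ComputableRealSeq x) : ComputableRealSeq fun i => -x i := by
  obtain ⟨r, hr, h⟩ := hx
  refine ⟨_, hr.neg, fun i k => ?_⟩
  have := h i k
  rw [abs_sub_comm] at this
  push_cast
  rwa [neg_sub_neg]

theorem add (hx : ComputableRealSeq x) (hy : ComputableRealSeq y) :
    ComputableRealSeq fun i => x i + y i := by
  obtain ⟨r, hr, h⟩ := hx
  obtain ⟨r', hr', h'⟩ := hy
  refine of_bound (hr.add hr') (.const 2) fun i k => ?_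
  push_cast
  rw [add_sub_add_comm]
  exact (abs_add_le _ _).trans (by linarith [h i k, h' i k])

theorem mul (hx : ComputableRealSeq x) (hy : ComputableRealSeq y) :
    ComputableRealSeq fun i => x i * y i := by
  obtain ⟨B, hB, hxB⟩ := hx.exists_bound
  obtain ⟨C, hC, hyC⟩ := hy.exists_bound
  obtain ⟨r, hr, h⟩ := hx
  obtain ⟨r', hr', h'⟩ := hy
  refine of_bound (hr.mul hr') (computable_add (computable_add hB hC) (.const 1)) fun i k => ?_
  have e : ((r (i, k) * r' (i, k) : ℚ) : ℝ) - x i * y i =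
      (r (i, k) - x i) * (r' (i, k) - y i) + (x i * (r' (i, k) - y i) + (r (i, k) - x i) * y i) := by
    push_cast
    ring
  have hk : (1 / 2 : ℝ) ^ k ≤ 1 := pow_le_one₀ (by norm_num) (by norm_num)
  have hk0 : (0 : ℝ) ≤ (1 / 2 : ℝ) ^ k := by positivity
  rw [e]
  refine (abs_add_le _ _).trans ((add_le_add_right (abs_add_le _ _) _).trans ?_)
  rw [abs_mul, abs_mul, abs_mul]
  have h1 := mul_le_mul (h i k) ((h' i k).trans hk) (abs_nonneg _) hk0
  have h2 := mul_le_mul (hxB i) (h' i k) (abs_nonneg _) (Nat.cast_nonneg _)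
  have h3 := mul_le_mul (h i k) (hyC i) (abs_nonneg _) hk0
  push_cast
  linarith

theorem abs (hx : ComputableRealSeq x) : ComputableRealSeq fun i => |x i| := by
  obtain ⟨r, hr, h⟩ := hx
  refine ⟨_, hr.abs, fun i k => ?_⟩
  push_cast
  exact (abs_abs_sub_abs_le_abs_sub _ _).trans (h i k)

theorem max_zero (hx : ComputableRealSeq x) : ComputableRealSeq fun i => max (x i) 0 := by
  obtain ⟨r, hr, h⟩ := hx
  refine ⟨_, hr.max_zero, fun i k => ?_⟩
  push_cast
  exact (abs_max_sub_max_le_abs _ _ _).trans (h i k)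

end ComputableRealSeq

/-! ### Effective evaluation of cosine and sine. -/

/-- The partial sum of the power series of `cos` (for `e = 0`) or of `sin` (for `e = 1`). -/
noncomputable def trigPartialSum {K : Type*} [Field K] (e n : ℕ) (y : K) : K :=
  ∑ j ∈ Finset.range n, (-1) ^ j * (y ^ (2 * j + e) * ((2 * j + e).factorial : K)⁻¹)

theorem sum_range_two_mul_exp_series (n : ℕ) (y : ℝ) :
    ∑ m ∈ Finset.range (2 * n), ((y : ℂ) * Complex.I) ^ m / (m.factorial : ℂ) =
      (trigPartialSum 0 n y : ℝ) + (trigPartialSum 1 n y : ℝ) * Complex.I := by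
  induction n with
  | zero => simp [trigPartialSum]
  | succ n ih =>
    rw [show 2 * (n + 1) = 2 * n + 1 + 1 by ring, Finset.sum_range_succ, Finset.sum_range_succ, ih]
    simp only [trigPartialSum, Finset.sum_range_succ]
    push_cast
    rw [mul_pow, mul_pow, pow_succ Complex.I, pow_mul Complex.I, Complex.I_sq]
    simp only [add_zero]
    ring

theorem norm_exp_sub_trigPartialSum_le {n : ℕ} {y : ℝ} (h : |y| ≤ n) :
    ‖Complex.exp (y * Complex.I) -
      ((trigPartialSum 0 n y : ℝ) + (trigPartialSum 1 n y : ℝ) * Complex.I)‖ ≤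
      |y| ^ (2 * n) / (2 * n).factorial * 2 := by
  have hy : ‖(y : ℂ) * Complex.I‖ = |y| := by simp
  -- The remainder bound requires |y| / (2n + 1) ≤ 1/2, which |y| ≤ n ensures.
  have := Complex.exp_bound' (x := y * Complex.I) (n := 2 * n) (by
    rw [hy, div_le_iff₀ (by positivity)]
    push_cast
    linarith)
  rwa [hy, sum_range_two_mul_exp_series] at this

theorem abs_trigPartialSum_zero_sub_cos_le {n : ℕ} {y : ℝ} (h : |y| ≤ n) :
    |trigPartialSum 0 n y - Real.cos y| ≤ |y| ^ (2 * n) / (2 * n).factorial * 2 := by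
  have := (Complex.abs_re_le_norm _).trans (norm_exp_sub_trigPartialSum_le h)
  rw [abs_sub_comm]
  simpa [Complex.exp_ofReal_mul_I_re] using this

theorem abs_trigPartialSum_one_sub_sin_le {n : ℕ} {y : ℝ} (h : |y| ≤ n) :
    |trigPartialSum 1 n y - Real.sin y| ≤ |y| ^ (2 * n) / (2 * n).factorial * 2 := by
  have := (Complex.abs_im_le_norm _).trans (norm_exp_sub_trigPartialSum_le h)
  rw [abs_sub_comm]
  simpa [Complex.exp_ofReal_mul_I_im] using this

theorem RecursiveRat.trigPartialSum {ι : Type} [Primcodable ι] {r : ι → ℚ} (hr : RecursiveRat r)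
    (e : ℕ) {n : ι → ℕ} (hn : Computable n) :
    RecursiveRat fun i => CompProb.trigPartialSum e (n i) (r i) := by
  have hj : Computable fun z : ι × ℕ => 2 * z.2 + e :=
    computable_add (computable_mul (.const 2) .snd) (.const e)
  have h1 : RecursiveRat fun _ : ι × ℕ => (-1 : ℚ) := by
    simpa using (natCast (.const 1)).neg (ι := ι × ℕ)
  exact ((h1.pow .snd).mul (((hr.comp .fst).pow hj).mul
    (inv_natCast (computable_factorial hj) fun _ => Nat.factorial_ne_zero _))).sum_range hn

theorem ratCast_trigPartialSum (e n : ℕ) (r : ℚ) :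
    ((trigPartialSum e n r : ℚ) : ℝ) = trigPartialSum e n (r : ℝ) := by
  simp [trigPartialSum]

/-- Factorials outgrow powers. Truncated subtraction puts the inequality in the form the zero search
expects, and the shift by `B` makes the degree large enough for the Taylor bound on [-B, B]. -/
theorem exists_degree_factorial (B k : ℕ) :
    ∃ n : ℕ, 2 * 2 ^ k * B ^ (2 * (n + B)) - (2 * (n + B)).factorial = 0 := by
  have h := (FloorSemiring.tendsto_pow_div_factorial_atTop (B : ℝ)).eventually_lt_const
    (show (0 : ℝ) < (2 * 2 ^ k)⁻¹ by positivity)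
  obtain ⟨n, hn⟩ := h.exists_forall_of_atTop
  refine ⟨n, Nat.sub_eq_zero_of_le ?_⟩
  have h1 := hn (2 * (n + B)) (by omega)
  rw [div_lt_iff₀ (by positivity), ← div_eq_inv_mul, lt_div_iff₀' (by positivity)] at h1
  exact_mod_cast h1.le

/-- The Taylor sum is evaluated at the rational approximation `r (i, k)`: one error 2^(-k) is the
Taylor remainder there, the other comes from replacing `r (i, k)` by `x i` through the Lipschitz
bound. -/
theorem ComputableRealSeq.of_trigPartialSum {ι : Type} [Primcodable ι] {x : ι → ℝ}
    (hx : ComputableRealSeq x) {e : ℕ} {g : ℝ → ℝ}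
    (hg : ∀ (n : ℕ) (y : ℝ), |y| ≤ n →
      |trigPartialSum e n y - g y| ≤ |y| ^ (2 * n) / (2 * n).factorial * 2)
    (hlip : ∀ y z, |g y - g z| ≤ |y - z|) : ComputableRealSeq fun i => g (x i) := by
  obtain ⟨B, hB, hxB⟩ := hx.exists_bound
  obtain ⟨r, hr, h⟩ := hx
  have hC : Computable fun z : ι × ℕ => B z.1 + 1 := computable_add (hB.comp .fst) (.const 1)
  have hC' : Computable fun z : (ι × ℕ) × ℕ => B z.1.1 + 1 := hC.comp .fst
  have hd : Computable fun z : (ι × ℕ) × ℕ => 2 * (z.2 + (B z.1.1 + 1)) :=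
    computable_mul (.const 2) (computable_add .snd hC')
  obtain ⟨N, hN, hN'⟩ := exists_computable_zero
    (f := fun z : (ι × ℕ) × ℕ => 2 * 2 ^ z.1.2 * (B z.1.1 + 1) ^ (2 * (z.2 + (B z.1.1 + 1))) -
      (2 * (z.2 + (B z.1.1 + 1))).factorial)
    (computable_sub (computable_mul
      (computable_mul (.const 2) (computable_pow (.const 2) (Computable.snd.comp .fst)))
      (computable_pow hC' hd)) (computable_factorial hd))
    fun z => exists_degree_factorial (B z.1 + 1) z.2
  refine of_bound (hr.trigPartialSum e (computable_add hN hC)) (.const 2) fun i k => ?_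
  have hk : (1 / 2 : ℝ) ^ k ≤ 1 := pow_le_one₀ (by norm_num) (by norm_num)
  have hrB : |(r (i, k) : ℝ)| ≤ (B i + 1 : ℕ) := by
    have h1 := hxB i
    have h2 := h i k
    push_cast
    linarith [abs_sub_abs_le_abs_sub (r (i, k) : ℝ) (x i)]
  set C := B i + 1
  set n := N (i, k) + C
  have h1 := hg n (r (i, k)) (hrB.trans (by exact_mod_cast Nat.le_add_left _ _))
  have h2 : |(r (i, k) : ℝ)| ^ (2 * n) / (2 * n).factorial * 2 ≤ (1 / 2 : ℝ) ^ k := by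
    have h3 : 2 * 2 ^ k * (C : ℝ) ^ (2 * n) ≤ (2 * n).factorial := by
      exact_mod_cast Nat.le_of_sub_eq_zero (hN' (i, k))
    have h4 : |(r (i, k) : ℝ)| ^ (2 * n) ≤ (C : ℝ) ^ (2 * n) :=
      pow_le_pow_left₀ (abs_nonneg _) hrB _
    rw [one_div, inv_pow, div_mul_eq_mul_div, div_le_iff₀ (by positivity), ← div_eq_inv_mul,
      le_div_iff₀ (by positivity)]
    refine le_trans ?_ h3
    calc |(r (i, k) : ℝ)| ^ (2 * n) * 2 * 2 ^ k = 2 * 2 ^ k * |(r (i, k) : ℝ)| ^ (2 * n) := by ring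
      _ ≤ _ := by gcongr
  rw [ratCast_trigPartialSum]
  refine (abs_sub_le _ (g (r (i, k))) _).trans ?_
  have h5 := (hlip (r (i, k)) (x i)).trans (h i k)
  push_cast
  linarith

theorem ComputableRealSeq.cos {ι : Type} [Primcodable ι] {x : ι → ℝ} (hx : ComputableRealSeq x) :
    ComputableRealSeq fun i => Real.cos (x i) :=
  hx.of_trigPartialSum (fun _ _ => abs_trigPartialSum_zero_sub_cos_le) Real.abs_cos_sub_cos_le

theorem ComputableRealSeq.sin {ι : Type} [Primcodable ι] {x : ι → ℝ} (hx : ComputableRealSeq x) :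
    ComputableRealSeq fun i => Real.sin (x i) :=
  hx.of_trigPartialSum (fun _ _ => abs_trigPartialSum_one_sub_sin_le) Real.abs_sin_sub_sin_le

end CompProb

namespace CompProb

theorem ComputableComplexSeq.of_re_im {ι : Type} [Primcodable ι] {z : ι → ℂ}
    (hre : ComputableRealSeq fun i => (z i).re) (him : ComputableRealSeq fun i => (z i).im) :
    ComputableComplexSeq z := by
  obtain ⟨r, hr, h⟩ := hre
  obtain ⟨s, hs, h'⟩ := him
  have hk : Computable fun w : ι × ℕ => (w.1, w.2 + 1) :=
    Computable.fst.pair (computable_add .snd (.const 1))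
  refine ⟨_, _, hr.comp hk, hs.comp hk, fun i k => (Complex.norm_le_abs_re_add_abs_im _).trans ?_⟩
  have h1 := h i (k + 1)
  have h2 := h' i (k + 1)
  simp only [Complex.sub_re, Complex.add_re, Complex.mul_re, Complex.sub_im, Complex.add_im,
    Complex.mul_im, Complex.ratCast_re, Complex.ratCast_im, Complex.I_re, Complex.I_im, mul_zero,
    mul_one, add_zero, zero_add, sub_zero]
  rw [pow_succ] at h1 h2
  linarith

/-! ### Tent functions as compactly supported cut-offs. -/

/-- The tent function with support `[-(N + 1), N + 1]` and value `1` at the origin. -/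
noncomputable def tent (N : ℕ) (x : ℝ) : ℝ := max (1 - |x| * ((N + 1 : ℕ) : ℝ)⁻¹) 0

theorem tent_nonneg (N : ℕ) (x : ℝ) : 0 ≤ tent N x := le_max_right _ _

theorem tent_le_one (N : ℕ) (x : ℝ) : tent N x ≤ 1 :=
  max_le (sub_le_self _ (by positivity)) zero_le_one

theorem tent_eq_zero {N : ℕ} {x : ℝ} (h : ((N + 1 : ℕ) : ℝ) ≤ |x|) : tent N x = 0 := by
  refine max_eq_right (sub_nonpos.2 ?_)
  rwa [← div_eq_mul_inv, one_le_div (by positivity)]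

theorem abs_tent_sub_tent_le (N : ℕ) (x y : ℝ) : |tent N x - tent N y| ≤ |x - y| := by
  refine (abs_max_sub_max_le_abs _ _ _).trans ?_
  rw [sub_sub_sub_cancel_left, ← sub_mul, abs_mul, abs_sub_comm x,
    abs_of_nonneg (a := ((N + 1 : ℕ) : ℝ)⁻¹) (by positivity)]
  refine (mul_le_of_le_one_right (abs_nonneg _) ?_).trans (abs_abs_sub_abs_le_abs_sub _ _)
  exact inv_le_one_of_one_le₀ (by exact_mod_cast Nat.le_add_left 1 N)

theorem continuous_tent (N : ℕ) : Continuous (tent N) := by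
  unfold tent
  fun_prop

theorem integrable_tent (ν : Measure ℝ) [IsFiniteMeasure ν] (N : ℕ) : Integrable (tent N) ν :=
  .of_bound (continuous_tent N).aestronglyMeasurable 1 <| .of_forall fun x => by
    rw [Real.norm_eq_abs, abs_of_nonneg (tent_nonneg N x)]
    exact tent_le_one N x

theorem tendsto_tent (x : ℝ) : Filter.Tendsto (fun N => tent N x) Filter.atTop (nhds 1) := by
  have h1 : Filter.Tendsto (fun N : ℕ => ((N + 1 : ℕ) : ℝ)⁻¹) Filter.atTop (nhds 0) :=
    tendsto_inv_atTop_zero.comp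
      (tendsto_natCast_atTop_atTop.comp (Filter.tendsto_add_atTop_nat 1))
  have := ((h1.const_mul |x|).const_sub 1).max (tendsto_const_nhds (x := (0 : ℝ)))
  simpa [tent] using this

theorem tendsto_integral_tent (ν : Measure ℝ) [IsProbabilityMeasure ν] :
    Filter.Tendsto (fun N => ∫ x, tent N x ∂ν) Filter.atTop (nhds 1) := by
  have := tendsto_integral_of_dominated_convergence (μ := ν) (F := tent) (f := fun _ => 1)
    (fun _ => 1) (fun N => (continuous_tent N).aestronglyMeasurable) (integrable_const 1)
    (fun N => .of_forall fun x => by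
      rw [Real.norm_eq_abs, abs_of_nonneg (tent_nonneg N x)]
      exact tent_le_one N x)
    (.of_forall tendsto_tent)
  simpa using this

/-- Multiplying the dilates of a bounded Lipschitz function by tents of growing width gives a
computable sequence of functions with compact support. -/
theorem computableCompactSupport_tent_mul {t : ℕ → ℝ} (ht : ComputableRealSeq t) {g : ℝ → ℝ}
    (hg : ∀ y : ℕ × ℕ → ℝ, ComputableRealSeq y → ComputableRealSeq fun i => g (y i))
    (hlip : ∀ y z, |g y - g z| ≤ |y - z|) (hbdd : ∀ y, |g y| ≤ 1) :
    -- A single index `l` codes both the dilation index and the tent width.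
    ComputableCompactSupport fun l x => tent l.unpair.2 x * g (t l.unpair.1 * x) := by
  have h1 : Computable fun l : ℕ => l.unpair.1 := Computable.fst.comp .unpair
  have h2 : Computable fun l : ℕ => l.unpair.2 := Computable.snd.comp .unpair
  have hs : Computable fun l : ℕ => l.unpair.2 + 1 := computable_add h2 (.const 1)
  refine ⟨⟨fun x hx => ?_, ?_⟩, _, hs, fun n x h => by
    beta_reduce; rw [tent_eq_zero h, zero_mul]⟩
  · have hx' : ComputableRealSeq fun i : ℕ × ℕ => x i.2 := hx.comp .snd
    have ht' : ComputableRealSeq fun i : ℕ × ℕ => t i.1.unpair.1 := ht.comp (h1.comp .fst)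
    have hi : ComputableRealSeq fun i : ℕ × ℕ =>
        (((((i.1.unpair.2 + 1 : ℕ) : ℚ)⁻¹ : ℚ)) : ℝ) :=
      .of_rat (RecursiveRat.inv_natCast (hs.comp .fst) fun _ => Nat.succ_ne_zero _)
    have h1' : ComputableRealSeq fun _ : ℕ × ℕ => (((1 : ℕ) : ℚ) : ℝ) :=
      .of_rat (RecursiveRat.natCast (.const 1))
    have := ((h1'.add (hx'.abs.mul hi).neg).max_zero).mul (hg _ (ht'.mul hx'))
    simpa [tent, sub_eq_add_neg] using this
  · obtain ⟨B, hB, htB⟩ := ht.exists_bound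
    -- The product is (b + 1)-Lipschitz, 1 from the tent and b from the dilated `g`, and b + 1 ≤
    -- 2^(b + 1).
    refine ⟨fun z => z.2.2 + (B z.1.unpair.1 + 1), computable_add
      (Computable.snd.comp .snd) (computable_add (hB.comp (h1.comp .fst)) (.const 1)),
      fun n L k x y _ _ hxy => ?_⟩
    set b := B n.unpair.1
    have e : tent n.unpair.2 x * g (t n.unpair.1 * x) - tent n.unpair.2 y * g (t n.unpair.1 * y) =
        (tent n.unpair.2 x - tent n.unpair.2 y) * g (t n.unpair.1 * x) +
        tent n.unpair.2 y * (g (t n.unpair.1 * x) - g (t n.unpair.1 * y)) := by ring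
    have h3 : |tent n.unpair.2 x - tent n.unpair.2 y| * |g (t n.unpair.1 * x)| ≤ |x - y| * 1 :=
      mul_le_mul (abs_tent_sub_tent_le _ _ _) (hbdd _) (abs_nonneg _) (abs_nonneg _)
    have h4 : |tent n.unpair.2 y| * |g (t n.unpair.1 * x) - g (t n.unpair.1 * y)| ≤
        1 * (b * |x - y|) := by
      refine mul_le_mul ?_ ((hlip _ _).trans ?_) (abs_nonneg _) zero_le_one
      · rw [abs_of_nonneg (tent_nonneg _ _)]
        exact tent_le_one _ _
      · rw [← mul_sub, abs_mul]
        exact mul_le_mul_of_nonneg_right (htB _) (abs_nonneg _)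
    have h5 : ((b + 1 : ℕ) : ℝ) * (1 / 2 : ℝ) ^ (b + 1) ≤ 1 := by
      rw [one_div, inv_pow]
      refine (mul_inv_le_iff₀ (by positivity)).2 ?_
      rw [one_mul]
      exact_mod_cast Nat.lt_two_pow_self.le
    rw [e]
    calc _ ≤ ((b + 1 : ℕ) : ℝ) * |x - y| := by
          refine (abs_add_le _ _).trans ?_
          rw [abs_mul, abs_mul]
          push_cast
          linarith
      _ < ((b + 1 : ℕ) : ℝ) * ((1 / 2 : ℝ) ^ (k + (b + 1))) :=
          mul_lt_mul_of_pos_left hxy (by positivity)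
      _ = (1 / 2 : ℝ) ^ k * (((b + 1 : ℕ) : ℝ) * (1 / 2 : ℝ) ^ (b + 1)) := by ring
      _ ≤ (1 / 2 : ℝ) ^ k := mul_le_of_le_one_right (by positivity) h5

/-! ### Effective tightness and integrals of bounded Lipschitz functions. -/

namespace ComputableDistSeq

variable {μ : ℕ → Measure ℝ} [∀ m, IsProbabilityMeasure (μ m)]

/-- A computable sequence of probability distributions is effectively tight. -/
theorem exists_tent (hμ : ComputableDistSeq μ) : ∃ N : ℕ × ℕ → ℕ, Computable N ∧
    ∀ m k, 1 - (1 / 2 : ℝ) ^ k ≤ ∫ x, tent (N (m, k)) x ∂(μ m) := by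
  have h0 : ComputableRealSeq fun _ : ℕ => (((0 : ℕ) : ℚ) : ℝ) :=
    .of_rat (RecursiveRat.natCast (.const 0))
  -- Dilation by 0 turns the cosine into the constant 1, leaving the bare tents.
  have hI := hμ _ (computableCompactSupport_tent_mul h0 (fun _ hy => hy.cos)
    Real.abs_cos_sub_cos_le Real.abs_cos_le_one)
  have hI' : ComputableRealSeq fun i : ℕ × ℕ => ∫ x, tent i.2 x ∂(μ i.1) := by
    simpa using hI.comp (e := fun i : ℕ × ℕ => (i.1, Nat.pair 0 i.2)) (Computable.fst.pair
      (Primrec₂.natPair.to_comp.comp (.const 0) .snd))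
  obtain ⟨r, hr, h⟩ := hI'
  have hidx : Computable fun z : (ℕ × ℕ) × ℕ => ((z.1.1, z.2), z.1.2 + 2) :=
    ((Computable.fst.comp .fst).pair .snd).pair
      (computable_add (Computable.snd.comp .fst) (.const 2))
  have hpow : RecursiveRat fun z : (ℕ × ℕ) × ℕ => (((2 : ℕ) : ℚ)⁻¹) ^ (z.1.2 + 1) :=
    (RecursiveRat.inv_natCast (.const 2) fun _ => two_ne_zero).pow
      (computable_add (Computable.snd.comp .fst) (.const 1))
  have hone : RecursiveRat fun _ : (ℕ × ℕ) × ℕ => ((1 : ℕ) : ℚ) :=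
    RecursiveRat.natCast (.const 1)
  -- The search tests whether a rational approximation within 2^(-(k+2)) is at least 1 - 2^(-(k+1)).
  -- An integral above 1 - 2^(-(k+2)) passes, and passing forces the integral above 1 - 2^(-k).
  obtain ⟨N, hN, hN'⟩ := ((hr.comp hidx).add (hpow.add hone.neg)).exists_computable_nonneg
    fun z => by
      have hlim := (tendsto_integral_tent (μ z.1)).eventually_const_lt
        (show 1 - (1 / 2 : ℝ) ^ (z.2 + 2) < 1 from sub_lt_self _ (by positivity))
      obtain ⟨n, hn⟩ := hlim.exists
      refine ⟨n, ?_⟩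
      have h1 := (abs_le.1 (h (z.1, n) (z.2 + 2))).1
      rw [← Rat.cast_nonneg (K := ℝ)]
      push_cast
      have e : (1 / 2 : ℝ) ^ (z.2 + 2) = 2⁻¹ ^ (z.2 + 1) / 2 := by ring
      rw [e] at h1 hn
      linarith
  refine ⟨N, hN, fun m k => ?_⟩
  have h1 := (abs_le.1 (h (m, N (m, k)) (k + 2))).2
  have h2 := hN' (m, k)
  rw [← Rat.cast_nonneg (K := ℝ)] at h2
  push_cast at h2
  have e : (1 / 2 : ℝ) ^ (k + 2) = (1 / 2) ^ k / 4 := by ring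
  have e' : (2⁻¹ : ℝ) ^ (k + 1) = (1 / 2) ^ k / 2 := by ring
  have hk : (0 : ℝ) < (1 / 2) ^ k := by positivity
  rw [e] at h1
  rw [e'] at h2
  dsimp only at h1
  linarith

theorem computableRealSeq_integral (hμ : ComputableDistSeq μ) {t : ℕ → ℝ}
    (ht : ComputableRealSeq t) {g : ℝ → ℝ}
    (hg : ∀ y : ℕ × ℕ → ℝ, ComputableRealSeq y → ComputableRealSeq fun i => g (y i))
    (hlip : ∀ y z, |g y - g z| ≤ |y - z|) (hbdd : ∀ y, |g y| ≤ 1) :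
    ComputableRealSeq fun i : ℕ × ℕ => ∫ x, g (t i.2 * x) ∂(μ i.1) := by
  obtain ⟨N, hN, hN'⟩ := hμ.exists_tent
  obtain ⟨r, hr, h⟩ := hμ _ (computableCompactSupport_tent_mul ht hg hlip hbdd)
  have hidx : Computable fun z : (ℕ × ℕ) × ℕ =>
      ((z.1.1, Nat.pair z.1.2 (N (z.1.1, z.2))), z.2) :=
    ((Computable.fst.comp .fst).pair (Primrec₂.natPair.to_comp.comp (Computable.snd.comp .fst)
      (hN.comp ((Computable.fst.comp .fst).pair .snd)))).pair .snd
  -- One 2^(-k) for approximating the cut-off integral, one for the mass lost by the cut-off.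
  refine .of_bound (hr.comp hidx) (.const 2) fun i k => ?_
  obtain ⟨m, n⟩ := i
  have h1 := h (m, Nat.pair n (N (m, k))) k
  have h2 := hN' m k
  simp only [Nat.unpair_pair] at h1
  set w := tent (N (m, k))
  have hgc : Continuous g :=
    (LipschitzWith.of_dist_le_mul (K := 1) fun y z => by
      simpa [Real.dist_eq] using hlip y z).continuous
  have hgi : Integrable (fun x => g (t n * x)) (μ m) :=
    .of_bound (by fun_prop) 1 (.of_forall fun x => hbdd _)
  have hw : Integrable w (μ m) := integrable_tent _ _
  have hwg : Integrable (fun x => w x * g (t n * x)) (μ m) :=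
    hw.mul_bdd (c := 1) hgi.aestronglyMeasurable (.of_forall fun x => hbdd _)
  have h3 : |∫ x, w x * g (t n * x) ∂(μ m) - ∫ x, g (t n * x) ∂(μ m)| ≤
      ∫ x, (1 - w x) ∂(μ m) := by
    rw [← integral_sub hwg hgi, ← Real.norm_eq_abs]
    refine norm_integral_le_of_norm_le ((integrable_const 1).sub hw) (.of_forall fun x => ?_)
    have hx : (0 : ℝ) ≤ 1 - w x := sub_nonneg.2 (tent_le_one _ _)
    rw [← sub_one_mul, Real.norm_eq_abs, abs_mul, abs_sub_comm, abs_of_nonneg hx]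
    exact mul_le_of_le_one_right hx (hbdd _)
  rw [integral_sub (integrable_const 1) hw, integral_const, probReal_univ, one_smul] at h3
  refine (abs_sub_le _ _ _).trans ((add_le_add h1 h3).trans ?_)
  push_cast
  linarith

end ComputableDistSeq

/-! ### Uniform continuity of characteristic functions. -/

theorem norm_exp_mul_I_sub_exp_mul_I_le (a b : ℝ) :
    ‖Complex.exp (a * Complex.I) - Complex.exp (b * Complex.I)‖ ≤ |a - b| := by
  have e : Complex.exp (a * Complex.I) - Complex.exp (b * Complex.I) =
      Complex.exp (b * Complex.I) * (Complex.exp (Complex.I * (a - b : ℝ)) - 1) := by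
    rw [mul_sub_one, ← Complex.exp_add]
    congr 2
    push_cast
    ring
  rw [e, norm_mul, Complex.norm_exp_ofReal_mul_I, one_mul]
  exact Real.norm_exp_I_mul_ofReal_sub_one_le

theorem integrable_exp_mul_I (ν : Measure ℝ) [IsFiniteMeasure ν] (t : ℝ) :
    Integrable (fun x : ℝ => Complex.exp (t * x * Complex.I)) ν :=
  .of_bound (by fun_prop) 1 <| .of_forall fun x => by
    rw [← Complex.ofReal_mul, Complex.norm_exp_ofReal_mul_I]

/-- The integrand is at most |x| |t - u| where |x| ≤ N + 1; elsewhere it is at most 2, which equals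
2(1 - tent) because the tent vanishes there. -/
theorem norm_charFun_sub_charFun_le (ν : Measure ℝ) [IsProbabilityMeasure ν] (N : ℕ) (t u : ℝ) :
    ‖charFun ν t - charFun ν u‖ ≤ (N + 1 : ℕ) * |t - u| + 2 * (1 - ∫ x, tent N x ∂ν) := by
  have hw := integrable_tent ν N
  have h1 : Integrable (fun x => 2 * (1 - tent N x)) ν := ((integrable_const 1).sub hw).const_mul 2
  rw [charFun_apply_real, charFun_apply_real,
    ← integral_sub (integrable_exp_mul_I ν t) (integrable_exp_mul_I ν u)]
  refine (norm_integral_le_of_norm_le ((integrable_const ((N + 1 : ℕ) * |t - u|)).add h1)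
    (.of_forall fun x => ?_)).trans_eq ?_
  · simp only [Pi.add_apply]
    rw [← Complex.ofReal_mul, ← Complex.ofReal_mul]
    rcases le_total ((N + 1 : ℕ) : ℝ) |x| with hx | hx
    · rw [tent_eq_zero hx]
      refine (norm_sub_le _ _).trans ?_
      rw [Complex.norm_exp_ofReal_mul_I, Complex.norm_exp_ofReal_mul_I]
      have : (0 : ℝ) ≤ (N + 1 : ℕ) * |t - u| := by positivity
      linarith
    · refine (norm_exp_mul_I_sub_exp_mul_I_le _ _).trans ?_
      rw [← sub_mul, abs_mul, mul_comm]
      have h2 := mul_le_mul_of_nonneg_right hx (abs_nonneg (t - u))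
      have h3 := tent_le_one N x
      linarith
  · simp only [Pi.add_apply]
    rw [integral_add (integrable_const _) h1, integral_const_mul 2,
      integral_sub (integrable_const 1) hw]
    simp

end CompProb

theorem theorem4p1 (μ : ℕ → MeasureTheory.Measure ℝ)
    [∀ m, MeasureTheory.IsProbabilityMeasure (μ m)]
    (hμ : CompProb.ComputableDistSeq μ) :
    CompProb.UniformlyComputableFunSeq fun m => MeasureTheory.charFun (μ m) := by
  constructor
  · intro t ht
    refine .of_re_im ?_ ?_
    · have h := hμ.computableRealSeq_integral ht (fun _ hy => hy.cos) Real.abs_cos_sub_cos_le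
        Real.abs_cos_le_one
      convert! h using 2 with i
      rw [charFun_apply_real]
      refine (integral_re (CompProb.integrable_exp_mul_I (μ i.1) (t i.2))).symm.trans ?_
      refine integral_congr_ae (.of_forall fun x => ?_)
      simp only [← Complex.ofReal_mul]
      exact Complex.exp_ofReal_mul_I_re _
    · have h := hμ.computableRealSeq_integral ht (fun _ hy => hy.sin) Real.abs_sin_sub_sin_le
        Real.abs_sin_le_one
      convert! h using 2 with i
      rw [charFun_apply_real]
      refine (integral_im (CompProb.integrable_exp_mul_I (μ i.1) (t i.2))).symm.trans ?_
      refine integral_congr_ae (.of_forall fun x => ?_)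
      simp only [← Complex.ofReal_mul]
      exact Complex.exp_ofReal_mul_I_im _
  · obtain ⟨N, hN, hN'⟩ := hμ.exists_tent
    have hk : Computable fun z : ℕ × ℕ => (z.1, z.2 + 2) :=
      Computable.fst.pair (CompProb.computable_add .snd (.const 2))
    -- Tightness at level k + 2 makes the tail term at most 2^(-(k+1)). The extra n + 1 places
    -- absorb the Lipschitz factor n + 1 ≤ 2^(n+1), so the other term is below 2^(-(k+1)).
    refine ⟨fun z => z.2 + 1 + (N (z.1, z.2 + 2) + 1), CompProb.computable_add
      (CompProb.computable_add .snd (.const 1)) (CompProb.computable_add (hN.comp hk) (.const 1)),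
      fun m k t u h => (CompProb.norm_charFun_sub_charFun_le (μ m) (N (m, k + 2)) t u).trans_lt ?_⟩
    have h1 := hN' m (k + 2)
    set n := N (m, k + 2)
    have h2 : ((n + 1 : ℕ) : ℝ) * |t - u| < (1 / 2 : ℝ) ^ (k + 1) := by
      have h3 : ((n + 1 : ℕ) : ℝ) ≤ 2 ^ (n + 1) := by exact_mod_cast Nat.lt_two_pow_self.le
      calc ((n + 1 : ℕ) : ℝ) * |t - u| ≤ 2 ^ (n + 1) * |t - u| := by gcongr
        _ < 2 ^ (n + 1) * (1 / 2 : ℝ) ^ (k + 1 + (n + 1)) := by gcongr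
        _ = (1 / 2 : ℝ) ^ (k + 1) := by
          rw [pow_add _ (k + 1), mul_left_comm, ← mul_pow]
          norm_num
    have e : (1 / 2 : ℝ) ^ (k + 2) = (1 / 2) ^ k / 4 := by ring
    have e' : (1 / 2 : ℝ) ^ (k + 1) = (1 / 2) ^ k / 2 := by ring
    rw [e] at h1
    rw [e'] at h2
    linarith
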